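/- Let $k,n,m\ge 0$ be integers. The conditional restricted Boltzmann machine $\mathrm{RBM}^k_{n,m}$ is the set of all conditional distributions on $y\in\{0,1\}^n$ given $x\in\{0,1\}^k$ of the form $$p(y|x)=\frac{\sum_{z\in\{0,1\}^m}\exp(z^\top Vx+z^\top Wy+b^\top y+c^\top z)}{\sum_{y'\in\{0,1\}^n}\sum_{z\in\{0,1\}^m}\exp(z^\top Vx+z^\top Wy'+b^\top y'+c^\top z)},$$ where $V\in\mathbb R^{m\times k}$, $W\in\mathbb R^{m\times n}$, $b\in\mathbb R^n$, $c\in\mathbb R^m$. It is regarded as a subset of $\mathbb R^{2^k\times 2^n}$. Let $A(N,d)$ be the largest cardinality of a subset of $\{0,1\}^N$ whose distinct elements are at least Hamming distance $d$ apart. Let $K(N,d)$ be the smallest cardinality of a subset of $\{0,1\}^N$ such that every element of $\{0,1\}^N$ is at Hamming distance at most $d$ from some element of the subset. Then $\mathrm{RBM}^k_{n,m}$ has the expected dimension in the following cases: 1. $\dim(\mathrm{RBM}^k_{n,m})=(k+n+1)m+n$, the number of parameters, whenever $n\ge 2$ and $m+1\le A(k+n,4)$. 2. $\dim(\mathrm{RBM}^k_{n,m})=2^k(2^n-1)$,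 the dimension of the polytope of all conditional distributions, whenever $m\ge K(k+n,1)$. Here $\dim(\mathrm{RBM}^k_{n,m})=d$ means that the set $\mathrm{RBM}^k_{n,m}$ has Hausdorff dimension $d$ and that $d$ is also the maximum, over all parameters $(V,W,b,c)$, of the rank of the Jacobian of the parametrization $(V,W,b,c)\mapsto p$ above. -/

import Mathlib

noncomputable section

/-- The set `{0,1}^n` of binary vectors of length `n`. -/
abbrev Cube (n : ℕ) : Type := Fin n → Bool

/-- A binary state, read as the real number `0` or `1`. -/
def bit (b : Bool) : ℝ := if b then 1 else 0

/-- The parameters `(V, W, b, c)` of a conditional restricted Boltzmann machine with `k` input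
units, `n` output units and `m` hidden units: interaction weights `V ∈ ℝ^(m × k)`,
`W ∈ ℝ^(m × n)` and biases `b ∈ ℝ^n`, `c ∈ ℝ^m`. -/
abbrev CRBMParam (k n m : ℕ) : Type :=
  (Fin m → Fin k → ℝ) × (Fin m → Fin n → ℝ) × (Fin n → ℝ) × (Fin m → ℝ)

/-- The exponent `zᵀ V x + zᵀ W y + bᵀ y + cᵀ z`. -/
def crbmExponent {k n m : ℕ} (θ : CRBMParam k n m)
    (x : Cube k) (y : Cube n) (z : Cube m) : ℝ :=
  (∑ i, ∑ j, bit (z i) * θ.1 i j * bit (x j))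
    + (∑ i, ∑ j, bit (z i) * θ.2.1 i j * bit (y j))
    + (∑ j, θ.2.2.1 j * bit (y j))
    + ∑ i, θ.2.2.2 i * bit (z i)

/-- The normalization function, at the input `x`. -/
def crbmZ {k n m : ℕ} (θ : CRBMParam k n m) (x : Cube k) : ℝ :=
  ∑ y : Cube n, ∑ z : Cube m, Real.exp (crbmExponent θ x y z)

/-- The parametrization of the model: `crbmMap k n m θ x y = p(y | x)`. -/
def crbmMap (k n m : ℕ) (θ : CRBMParam k n m) : Cube k → Cube n → ℝ :=
  fun x y => (∑ z : Cube m, Real.exp (crbmExponent θ x y z)) / crbmZ θ x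

/-- The model: the set of all conditional distributions `p(y | x)` represented by a conditional
restricted Boltzmann machine with `k` input, `n` output and `m` hidden units, a subset of
`ℝ^(2^k × 2^n)`. -/
def CRBM (k n m : ℕ) : Set (Cube k → Cube n → ℝ) := Set.range (crbmMap k n m)

theorem crbmZ_pos {k n m : ℕ} (θ : CRBMParam k n m) (x : Cube k) : 0 < crbmZ θ x :=
  Finset.sum_pos (fun _ _ => Finset.sum_pos (fun _ _ => Real.exp_pos _) Finset.univ_nonempty)
    Finset.univ_nonempty

/-- The parametrization is smooth, so that its Frechet derivative is the Jacobian. -/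
theorem contDiff_crbmMap (k n m : ℕ) : ContDiff ℝ (⊤ : ℕ∞) (crbmMap k n m) := by
  have h : ∀ (x : Cube k) (y : Cube n) (z : Cube m),
      ContDiff ℝ (⊤ : ℕ∞) fun θ : CRBMParam k n m => Real.exp (crbmExponent θ x y z) := by
    intro x y z
    unfold crbmExponent
    fun_prop
  refine contDiff_pi.2 fun x => contDiff_pi.2 fun y => ?_
  refine ContDiff.div (ContDiff.sum fun z _ => h x y z) ?_ fun θ => (crbmZ_pos θ x).ne'
  exact ContDiff.sum fun y' _ => ContDiff.sum fun z _ => h x y' z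

/-- The rank of the Jacobian of the parametrization at the parameter `θ`. -/
def crbmJacobianRank (k n m : ℕ) (θ : CRBMParam k n m) : ℕ :=
  Module.finrank ℝ (LinearMap.range (fderiv ℝ (crbmMap k n m) θ).toLinearMap)

/-- The model `CRBM k n m` has dimension `d`: the set has Hausdorff dimension `d`, and `d` is the
maximal rank of the Jacobian of its parametrization. -/
def CRBMHasDim (k n m d : ℕ) : Prop :=
  dimH (CRBM k n m) = d ∧ IsGreatest (Set.range (crbmJacobianRank k n m)) d

/-- `A(n, d)`: the largest cardinality of a subset of `{0,1}^n` whose distinct elements are at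
least Hamming distance `d` apart. -/
def codeA (n d : ℕ) : ℕ :=
  sSup {N | ∃ C : Finset (Cube n),
    (∀ u ∈ C, ∀ v ∈ C, u ≠ v → d ≤ hammingDist u v) ∧ C.card = N}

/-- `K(n, d)`: the smallest cardinality of a subset of `{0,1}^n` such that every element of
`{0,1}^n` is at most Hamming distance `d` apart from that subset. -/
def coverK (n d : ℕ) : ℕ :=
  sInf {N | ∃ C : Finset (Cube n),
    (∀ v : Cube n, ∃ u ∈ C, hammingDist v u ≤ d) ∧ C.card = N}

end

open Module Filter Topology Set

/-! Upper bounds on the Hausdorff dimension are soft: a smooth image has at most as many dimensions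
as there are parameters, and the model lies in the affine space of matrices with row sums 1. Since
every Jacobian rank is at most the Hausdorff dimension, it remains to find one parameter with large
rank.

Summing out the hidden units, the unnormalized log-probability is `bᵀ y` plus a softplus of each
hidden input. Its derivative is `gatedMap`, gated by sigmoids; `rowContrast` removes the normalizer.
Scaling the hidden parameters to infinity turns the sigmoids into indicators of half-spaces, in
particular of Hamming balls of radius one. Rank is lower semicontinuous, so the rank of the limiting
map is a lower bound for some Jacobian rank (`exists_finrank_range_ballActivation_le`).

An affine function on the cube is determined by its values on such a ball, and these are arbitrary.
Hence the limiting map is surjective if the balls cover the cube, and injective modulo row constants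
if the centers form a code of distance 4 with one spare codeword. -/

theorem finrank_range_fderiv_le_dimH_range {E F : Type*} [NormedAddCommGroup E] [NormedSpace ℝ E]
    [FiniteDimensional ℝ E] [NormedAddCommGroup F] [NormedSpace ℝ F] [FiniteDimensional ℝ F]
    {f : E → F} (hf : ContDiff ℝ 1 f) (a : E) :
    (finrank ℝ (LinearMap.range (fderiv ℝ f a).toLinearMap) : ENNReal) ≤ dimH (range f) := by
  set R := LinearMap.range (fderiv ℝ f a).toLinearMap with hR
  -- Projecting linearly onto the range of the derivative makes `f` a submersion at `a`, so the
  -- projected image contains an open set; the projection is Lipschitz and cannot raise dimension.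
  obtain ⟨g, hg⟩ := LinearMap.exists_leftInverse_of_injective R.subtype R.ker_subtype
  let p : F →L[ℝ] R := LinearMap.toContinuousLinearMap g
  have hd : HasStrictFDerivAt (p ∘ f) (p.comp (fderiv ℝ f a)) a :=
    p.hasStrictFDerivAt.comp a (hf.contDiffAt.hasStrictFDerivAt (by norm_num))
  have hs : (p.comp (fderiv ℝ f a)).range = ⊤ := by
    rw [LinearMap.range_eq_top]
    rintro ⟨_, v, rfl⟩
    exact ⟨v, LinearMap.congr_fun hg ⟨_, v, rfl⟩⟩
  have hn : range (p ∘ f) ∈ 𝓝 ((p ∘ f) a) := by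
    rw [← hd.map_nhds_eq_of_surj hs]
    exact mem_map.2 (univ_mem' fun x => mem_range_self x)
  rw [← Real.dimH_of_mem_nhds hn, range_comp]
  exact p.lipschitz.dimH_image_le _

/-! ### Log-probabilities and their derivative -/

/-- The input `cᵢ + (V x)ᵢ + (W y)ᵢ` of a hidden unit, linear in the parameters. -/
def hiddenInput {k n m : ℕ} (i : Fin m) (x : Cube k) (y : Cube n) : CRBMParam k n m →ₗ[ℝ] ℝ where
  toFun θ := θ.2.2.2 i + ∑ j, θ.1 i j * bit (x j) + ∑ j, θ.2.1 i j * bit (y j)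
  map_add' θ η := by simp [add_mul, Finset.sum_add_distrib]; ring
  map_smul' r θ := by simp [mul_add, Finset.mul_sum, mul_assoc]

/-- The contribution `bᵀ y` of the output biases, linear in the parameters. -/
def outputInput {k n m : ℕ} (y : Cube n) : CRBMParam k n m →ₗ[ℝ] ℝ where
  toFun θ := ∑ j, θ.2.2.1 j * bit (y j)
  map_add' θ η := by simp [add_mul, Finset.sum_add_distrib]
  map_smul' r θ := by simp [Finset.mul_sum, mul_assoc]

theorem crbmExponent_eq {k n m : ℕ} (θ : CRBMParam k n m) (x : Cube k) (y : Cube n) (z : Cube m) :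
    crbmExponent θ x y z = outputInput y θ + ∑ i, bit (z i) * hiddenInput i x y θ := by
  simp only [crbmExponent, outputInput, hiddenInput, LinearMap.coe_mk, AddHom.coe_mk, mul_add,
    Finset.sum_add_distrib, Finset.mul_sum, mul_assoc]
  rw [Finset.sum_congr rfl fun i _ => mul_comm (θ.2.2.2 i) (bit (z i))]
  ring

theorem sum_exp_crbmExponent {k n m : ℕ} (θ : CRBMParam k n m) (x : Cube k) (y : Cube n) :
    ∑ z, Real.exp (crbmExponent θ x y z) =
      Real.exp (outputInput y θ) * ∏ i, (1 + Real.exp (hiddenInput i x y θ)) := by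
  have h (i : Fin m) : 1 + Real.exp (hiddenInput i x y θ) =
      ∑ b : Bool, Real.exp (bit b * hiddenInput i x y θ) := by
    simp [bit, add_comm]
  simp only [h, Fintype.prod_sum, crbmExponent_eq, Real.exp_add, Finset.mul_sum, Real.exp_sum]

theorem log_sum_exp_crbmExponent {k n m : ℕ} (θ : CRBMParam k n m) (x : Cube k) (y : Cube n) :
    Real.log (∑ z, Real.exp (crbmExponent θ x y z)) =
      outputInput y θ + ∑ i, Real.log (1 + Real.exp (hiddenInput i x y θ)) := by
  rw [sum_exp_crbmExponent, Real.log_mul (Real.exp_pos _).ne'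
    (Finset.prod_pos fun _ _ => by positivity).ne', Real.log_exp, Real.log_prod]
  exact fun _ _ => by positivity

/-- The linear map with components `bᵀ y + ∑ᵢ aᵢ(x, y) (cᵢ + (V x)ᵢ + (W y)ᵢ)`: the derivative of
the unnormalized log-probabilities if `aᵢ` is the activation of the hidden unit `i`. -/
def gatedMap {k n m : ℕ} (a : Fin m → Cube k → Cube n → ℝ) :
    CRBMParam k n m →ₗ[ℝ] (Cube k → Cube n → ℝ) :=
  LinearMap.pi fun x => LinearMap.pi fun y => outputInput y + ∑ i, a i x y • hiddenInput i x y

theorem gatedMap_apply {k n m : ℕ} (a : Fin m → Cube k → Cube n → ℝ) (θ : CRBMParam k n m)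
    (x : Cube k) (y : Cube n) :
    gatedMap a θ x y = outputInput y θ + ∑ i, a i x y * hiddenInput i x y θ := by
  simp [gatedMap]

/-- Subtracting from each row `f x` its entry at `y = 0`. -/
def rowContrast (k n : ℕ) : (Cube k → Cube n → ℝ) →ₗ[ℝ] (Cube k → Cube n → ℝ) where
  toFun f x y := f x y - f x fun _ => false
  map_add' f g := by ext; simp; ring
  map_smul' r f := by ext; simp; ring

theorem rowContrast_apply {k n : ℕ} (f : Cube k → Cube n → ℝ) (x : Cube k) (y : Cube n) :
    rowContrast k n f x y = f x y - f x fun _ => false := rfl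

theorem hasDerivAt_log_one_add_exp (s : ℝ) :
    HasDerivAt (fun s => Real.log (1 + Real.exp s)) (Real.sigmoid s) s := by
  have h := ((Real.hasDerivAt_exp s).const_add 1).log (by positivity)
  convert h using 1
  rw [Real.sigmoid_def, Real.exp_neg]
  field_simp
  ring

theorem hasFDerivAt_log_sum_exp {k n m : ℕ} (θ : CRBMParam k n m) :
    HasFDerivAt (fun (θ : CRBMParam k n m) x y => Real.log (∑ z, Real.exp (crbmExponent θ x y z)))
      (LinearMap.toContinuousLinearMap
        (gatedMap fun i x y => Real.sigmoid (hiddenInput i x y θ))) θ := by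
  refine hasFDerivAt_pi'.2 fun x => hasFDerivAt_pi'.2 fun y => ?_
  simp only [log_sum_exp_crbmExponent]
  have h (i : Fin m) := (hasDerivAt_log_one_add_exp (hiddenInput i x y θ)).comp_hasFDerivAt θ
    (LinearMap.toContinuousLinearMap (hiddenInput i x y)).hasFDerivAt
  have h' := (LinearMap.toContinuousLinearMap (outputInput y)).hasFDerivAt.add
    (HasFDerivAt.fun_sum (u := Finset.univ) (x := θ) fun i _ => h i)
  refine h'.congr_fderiv ?_
  refine ContinuousLinearMap.ext fun η => ?_
  simp [gatedMap_apply]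

theorem crbmMap_pos {k n m : ℕ} (θ : CRBMParam k n m) (x : Cube k) (y : Cube n) :
    0 < crbmMap k n m θ x y :=
  div_pos (Finset.sum_pos (fun _ _ => Real.exp_pos _) Finset.univ_nonempty) (crbmZ_pos θ x)

/-- The normalizer depends on `x` only, so it cancels within a row. -/
theorem rowContrast_log_crbmMap {k n m : ℕ} (θ : CRBMParam k n m) :
    rowContrast k n (fun x y => Real.log (crbmMap k n m θ x y)) =
      rowContrast k n (fun x y => Real.log (∑ z, Real.exp (crbmExponent θ x y z))) := by
  have h (y : Cube n) (x : Cube k) : ∑ z, Real.exp (crbmExponent θ x y z) ≠ 0 :=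
    (Finset.sum_pos (fun _ _ => Real.exp_pos _) Finset.univ_nonempty).ne'
  ext x y
  simp only [rowContrast_apply, crbmMap, Real.log_div (h _ _) (crbmZ_pos θ x).ne']
  ring

/-- By the chain rule the contrasted gated map factors through the Jacobian, followed by the
derivative of the entrywise logarithm and the contrast. -/
theorem finrank_range_rowContrast_gatedMap_sigmoid_le {k n m : ℕ} (θ : CRBMParam k n m) :
    finrank ℝ (LinearMap.range
        (rowContrast k n ∘ₗ gatedMap fun i x y => Real.sigmoid (hiddenInput i x y θ))) ≤
      crbmJacobianRank k n m θ := by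
  let C := LinearMap.toContinuousLinearMap (rowContrast k n)
  have h1 := C.hasFDerivAt.comp θ (hasFDerivAt_log_sum_exp θ)
  have hp : HasFDerivAt (crbmMap k n m) (fderiv ℝ (crbmMap k n m) θ) θ :=
    ((contDiff_crbmMap k n m).differentiable (by simp) θ).hasFDerivAt
  have hl : DifferentiableAt ℝ (fun (p : Cube k → Cube n → ℝ) x y => Real.log (p x y))
      (crbmMap k n m θ) := by
    refine differentiableAt_pi.2 fun x => differentiableAt_pi.2 fun y => ?_
    exact DifferentiableAt.log (by fun_prop) (crbmMap_pos θ x y).ne'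
  have h2 := C.hasFDerivAt.comp θ (hl.hasFDerivAt.comp θ hp)
  have he := h1.unique (h2.congr_of_eventuallyEq
    (Eventually.of_forall fun θ => (rowContrast_log_crbmMap θ).symm))
  have he' : (rowContrast k n ∘ₗ gatedMap fun i x y => Real.sigmoid (hiddenInput i x y θ)) =
      (C.toLinearMap ∘ₗ (fderiv ℝ (fun (p : Cube k → Cube n → ℝ) x y => Real.log (p x y))
        (crbmMap k n m θ)).toLinearMap) ∘ₗ (fderiv ℝ (crbmMap k n m) θ).toLinearMap := by
    refine LinearMap.ext fun v => ?_
    exact DFunLike.congr_fun he v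
  rw [he', LinearMap.range_comp]
  exact Submodule.finrank_map_le _ _

/-! ### Passing to limits of activations -/

theorem continuous_gatedMap (k n m : ℕ) :
    Continuous fun a : Fin m → Cube k → Cube n → ℝ =>
      LinearMap.toContinuousLinearMap (rowContrast k n ∘ₗ gatedMap a) := by
  refine continuous_clm_apply.2 fun θ => ?_
  simp only [LinearMap.coe_toContinuousLinearMap', LinearMap.comp_apply]
  refine continuous_pi fun x => continuous_pi fun y => ?_
  simp only [rowContrast_apply, gatedMap_apply]
  fun_prop

/-- Having rank at least `r` is an open condition, so it passes from the limit to large `t`. The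
path `θ` itself may diverge, since `gatedMap` sees it only through the activations. -/
theorem exists_finrank_range_rowContrast_gatedMap_le {k n m : ℕ}
    (a : Fin m → Cube k → Cube n → ℝ) (θ : ℝ → CRBMParam k n m)
    (h : ∀ i x y, Tendsto (fun t => Real.sigmoid (hiddenInput i x y (θ t))) atTop (𝓝 (a i x y))) :
    ∃ η, finrank ℝ (LinearMap.range (rowContrast k n ∘ₗ gatedMap a)) ≤
      crbmJacobianRank k n m η := by
  have ht : Tendsto (fun t i x y => Real.sigmoid (hiddenInput i x y (θ t))) atTop (𝓝 a) :=
    tendsto_pi_nhds.2 fun i => tendsto_pi_nhds.2 fun x => tendsto_pi_nhds.2 fun y => h i x y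
  have ho := (isOpen_setOfPred_nat_le_rank (𝕜 := ℝ) (E := CRBMParam k n m)
    (F := Cube k → Cube n → ℝ)
    (finrank ℝ (LinearMap.range (rowContrast k n ∘ₗ gatedMap a)))).preimage
      (continuous_gatedMap k n m)
  have hr (L : CRBMParam k n m →ₗ[ℝ] (Cube k → Cube n → ℝ)) (r : ℕ) :
      (r : Cardinal) ≤ L.rank ↔ r ≤ finrank ℝ (LinearMap.range L) := by
    rw [LinearMap.rank, ← finrank_eq_rank, Nat.cast_le]
  obtain ⟨t, ht'⟩ := (ht.eventually (ho.mem_nhds ((hr _ _).2 le_rfl))).exists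
  exact ⟨θ t, ((hr _ _).1 ht').trans (finrank_range_rowContrast_gatedMap_sigmoid_le (θ t))⟩

/-! ### Affine functions on Hamming balls of radius one -/

theorem eq_or_exists_eq_update_of_hammingDist_le_one {N : ℕ} {u v : Cube N}
    (h : hammingDist v u ≤ 1) : v = u ∨ ∃ j, v = Function.update u j (!u j) := by
  by_cases hvu : v = u
  · exact Or.inl hvu
  obtain ⟨j, hj⟩ := Function.ne_iff.1 hvu
  refine Or.inr ⟨j, funext fun l => ?_⟩
  rcases eq_or_ne l j with rfl | hl
  · simpa using Bool.eq_not_of_ne hj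
  rw [Function.update_of_ne hl]
  by_contra hne
  exact hl (Finset.card_le_one.1 h l (by simpa using hne) j (by simpa using hj))

theorem hammingDist_update_le_one {N : ℕ} (u : Cube N) (j : Fin N) (b : Bool) :
    hammingDist (Function.update u j b) u ≤ 1 := by
  refine Finset.card_le_one.2 fun l hl l' hl' => ?_
  have h (l) (hl : Function.update u j b l ≠ u l) : l = j := by
    by_contra hne
    exact hl (Function.update_of_ne hne _ _)
  rw [h l (by simpa using hl), h l' (by simpa using hl')]

/-- The affine function `c + ⟨w, v⟩` on the vertices of the cube. -/
def cubeAffine {N : ℕ} (c : ℝ) (w : Fin N → ℝ) (v : Cube N) : ℝ := c + ∑ j, w j * bit (v j)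

theorem cubeAffine_update_not {N : ℕ} (c : ℝ) (w : Fin N → ℝ) (u : Cube N) (j : Fin N) :
    cubeAffine c w (Function.update u j (!u j)) =
      cubeAffine c w u + w j * (1 - 2 * bit (u j)) := by
  simp only [cubeAffine]
  rw [← Finset.add_sum_erase _ _ (Finset.mem_univ j),
    ← Finset.add_sum_erase Finset.univ (fun j => w j * bit (u j)) (Finset.mem_univ j),
    Finset.sum_congr rfl fun l hl => by rw [Function.update_of_ne (Finset.ne_of_mem_erase hl)]]
  cases u j <;> simp [bit] <;> ring

theorem one_sub_two_mul_bit_mul_self (b : Bool) : (1 - 2 * bit b) * (1 - 2 * bit b) = 1 := by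
  cases b <;> norm_num [bit]

theorem eq_zero_of_cubeAffine_eq_zero_on_ball {N : ℕ} {c : ℝ} {w : Fin N → ℝ} {u : Cube N}
    (h : ∀ v, hammingDist v u ≤ 1 → cubeAffine c w v = 0) : c = 0 ∧ w = 0 := by
  have hu := h u (by simp)
  have hw : w = 0 := by
    funext j
    have hj := h _ (hammingDist_update_le_one u j (!u j))
    rw [cubeAffine_update_not, hu, zero_add] at hj
    calc w j = w j * (1 - 2 * bit (u j)) * (1 - 2 * bit (u j)) := by
          rw [mul_assoc, one_sub_two_mul_bit_mul_self, mul_one]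
      _ = 0 := by rw [hj, zero_mul]
  exact ⟨by simpa [cubeAffine, hw] using hu, hw⟩

/-- The ball consists of `u` and its `N` neighbors, which are affinely independent; each slope is
read off along one edge, with the sign `1 - 2 * bit (u j)` of the flip. -/
theorem exists_cubeAffine_eq_on_ball {N : ℕ} (u : Cube N) (h : Cube N → ℝ) :
    ∃ c w, ∀ v, hammingDist v u ≤ 1 → cubeAffine c w v = h v := by
  let w : Fin N → ℝ := fun j => (h (Function.update u j (!u j)) - h u) * (1 - 2 * bit (u j))
  refine ⟨h u - ∑ j, w j * bit (u j), w, fun v hv => ?_⟩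
  have hu : cubeAffine (h u - ∑ j, w j * bit (u j)) w u = h u := by simp [cubeAffine]
  obtain rfl | ⟨j, rfl⟩ := eq_or_exists_eq_update_of_hammingDist_le_one hv
  · exact hu
  · rw [cubeAffine_update_not, hu, mul_assoc, one_sub_two_mul_bit_mul_self]
    ring

theorem cubeAffine_eq_sub_hammingDist {N : ℕ} (r : ℝ) (u v : Cube N) :
    cubeAffine (r - ∑ j, bit (u j)) (fun j => 2 * bit (u j) - 1) v = r - hammingDist v u := by
  have h : (hammingDist v u : ℝ) = ∑ j, (bit (u j) - (2 * bit (u j) - 1) * bit (v j)) := by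
    rw [hammingDist, Finset.card_filter, Nat.cast_sum]
    refine Finset.sum_congr rfl fun j _ => ?_
    cases u j <;> cases v j <;> norm_num [bit]
  rw [h, Finset.sum_sub_distrib, cubeAffine]
  ring

/-! ### Hidden units gated by Hamming balls -/

theorem hiddenInput_apply {k n m : ℕ} (θ : CRBMParam k n m) (i : Fin m) (x : Cube k)
    (y : Cube n) : hiddenInput i x y θ =
      cubeAffine (θ.2.2.2 i) (Fin.append (θ.1 i) (θ.2.1 i)) (Fin.append x y) := by
  simp [hiddenInput, cubeAffine, Fin.sum_univ_add, add_assoc]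

theorem outputInput_apply {k n m : ℕ} (θ : CRBMParam k n m) (x : Cube k) (y : Cube n) :
    outputInput y θ = cubeAffine 0 (Fin.append 0 θ.2.2.1) (Fin.append x y) := by
  simp [outputInput, cubeAffine, Fin.sum_univ_add]

/-- The parameters whose hidden units have prescribed affine input functions. -/
def crbmParamOfAffine {k n m : ℕ} (b : Fin n → ℝ) (c : Fin m → ℝ) (w : Fin m → Fin (k + n) → ℝ) :
    CRBMParam k n m :=
  (fun i j => w i (Fin.castAdd n j), fun i j => w i (Fin.natAdd k j), b, c)

theorem hiddenInput_crbmParamOfAffine {k n m : ℕ} (b : Fin n → ℝ) (c : Fin m → ℝ)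
    (w : Fin m → Fin (k + n) → ℝ) (i : Fin m) (x : Cube k) (y : Cube n) :
    hiddenInput i x y (crbmParamOfAffine b c w) = cubeAffine (c i) (w i) (Fin.append x y) := by
  rw [hiddenInput_apply]
  simp [crbmParamOfAffine, Fin.append_castAdd_natAdd]

theorem cubeAffine_smul {N : ℕ} (t c : ℝ) (w : Fin N → ℝ) (v : Cube N) :
    cubeAffine (t * c) (t • w) v = t * cubeAffine c w v := by
  simp [cubeAffine, mul_add, Finset.mul_sum, mul_assoc]

/-- The indicator functions of the Hamming balls of radius one about the points `u i`. -/
def ballActivation {k n m : ℕ} (u : Fin m → Cube (k + n)) : Fin m → Cube k → Cube n → ℝ :=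
  fun i x y => if hammingDist (Fin.append x y) (u i) ≤ 1 then 1 else 0

theorem exists_finrank_range_ballActivation_le {k n m : ℕ} (u : Fin m → Cube (k + n)) :
    ∃ θ, finrank ℝ (LinearMap.range (rowContrast k n ∘ₗ gatedMap (ballActivation u))) ≤
      crbmJacobianRank k n m θ := by
  -- The hidden input is `t` times 3/2 minus the distance to `u i`; 3/2 separates the ball from
  -- distances at least 2 and never gives zero.
  refine exists_finrank_range_rowContrast_gatedMap_le _ (fun t => crbmParamOfAffine 0
    (fun i => t * (3 / 2 - ∑ j, bit (u i j))) fun i => t • fun j => 2 * bit (u i j) - 1) ?_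
  intro i x y
  simp only [hiddenInput_crbmParamOfAffine, cubeAffine_smul, cubeAffine_eq_sub_hammingDist,
    ballActivation]
  split_ifs with h
  · have h' : (hammingDist (Fin.append x y) (u i) : ℝ) ≤ 1 := by exact_mod_cast h
    exact Real.tendsto_sigmoid_atTop.comp (tendsto_id.atTop_mul_const (by linarith))
  · have h' : (2 : ℝ) ≤ hammingDist (Fin.append x y) (u i) := by exact_mod_cast (by omega)
    exact Real.tendsto_sigmoid_atBot.comp (tendsto_id.atTop_mul_const_of_neg (by linarith))

theorem gatedMap_ballActivation_surjective {k n m : ℕ} {u : Fin m → Cube (k + n)}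
    (hu : ∀ v, ∃ i, hammingDist v (u i) ≤ 1) :
    Function.Surjective (gatedMap (ballActivation u)) := by
  intro f
  -- Each vertex is assigned to one ball containing it, so overlapping balls do not count a value
  -- twice.
  choose s hs using hu
  have h (i : Fin m) := exists_cubeAffine_eq_on_ball (u i) fun v =>
    if i = s v then f (fun j => v (Fin.castAdd n j)) (fun j => v (Fin.natAdd k j)) else 0
  choose c w hcw using h
  refine ⟨crbmParamOfAffine 0 c w, ?_⟩
  ext x y
  have ht (i : Fin m) : ballActivation u i x y * cubeAffine (c i) (w i) (Fin.append x y) =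
      if i = s (Fin.append x y) then f x y else 0 := by
    rw [ballActivation]
    split_ifs with h1 h2 h2
    · rw [hcw i _ h1, if_pos h2, one_mul]
      simp
    · rw [hcw i _ h1, if_neg h2, mul_zero]
    · exact absurd (h2 ▸ hs _) h1
    · rw [zero_mul]
  simp [gatedMap_apply, hiddenInput_crbmParamOfAffine, ht]
  simp [outputInput, crbmParamOfAffine]

theorem append_update_right {k n : ℕ} (x : Cube k) (y : Cube n) (j : Fin n) (b : Bool) :
    Fin.append x (Function.update y j b) =
      Function.update (Fin.append x y) (Fin.natAdd k j) b := by
  ext l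
  refine Fin.addCases (fun i => ?_) (fun i => ?_) l
  · rw [Function.update_of_ne (by simp [Fin.ext_iff]; omega)]
    simp
  · rcases eq_or_ne i j with rfl | h
    · simp
    · rw [Function.update_of_ne ((Fin.natAdd_injective n k).ne h)]
      simp [h]

/-- If the balls covered the row, flipping a bit of `y` could not change balls: the two centers
would be within 1 + 1 + 1 < 4. The whole row would then lie in one ball, which two free bits rule
out. -/
theorem exists_hammingDist_append_gt_one {k n m : ℕ} (hn : 2 ≤ n) {u : Fin m → Cube (k + n)}
    (hu : ∀ i j, i ≠ j → 4 ≤ hammingDist (u i) (u j)) (x : Cube k) :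
    ∃ y : Cube n, ∀ i, 1 < hammingDist (Fin.append x y) (u i) := by
  by_contra! hc
  have hstep (y : Cube n) (j : Fin n) (b : Bool) (i : Fin m)
      (hi : hammingDist (Fin.append x y) (u i) ≤ 1) :
      hammingDist (Fin.append x (Function.update y j b)) (u i) ≤ 1 := by
    obtain ⟨i', hi'⟩ := hc (Function.update y j b)
    rcases eq_or_ne i i' with rfl | hne
    · exact hi'
    have h1 := hu i i' hne
    have h2 := hammingDist_update_le_one (Fin.append x y) (Fin.natAdd k j) b
    rw [← append_update_right] at h2
    have h3 := hammingDist_triangle_left (u i) (u i') (Fin.append x y)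
    have h4 := hammingDist_triangle (Fin.append x y) (Fin.append x (Function.update y j b)) (u i')
    rw [hammingDist_comm (Fin.append x y) (Fin.append x (Function.update y j b))] at h4
    omega
  obtain ⟨i, hi⟩ := hc fun _ => false
  let p : Fin n := ⟨0, by omega⟩
  let q : Fin n := ⟨1, by omega⟩
  have hpq : p ≠ q := by simp [p, q]
  -- Setting two output bits opposite to those of the center leaves its ball.
  have h := hstep _ q (!u i (Fin.natAdd k q)) i (hstep _ p (!u i (Fin.natAdd k p)) i hi)
  have := Finset.card_le_one.1 h (Fin.natAdd k p) (by simp [Function.update_of_ne hpq])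
    (Fin.natAdd k q) (by simp)
  exact hpq (Fin.natAdd_injective n k this)

/-- For a kernel element the rows are constant. Near the spare codeword `o` no unit is active, so
the edges there in output directions give `b = 0`. Every row has a point outside all balls, so its
constant is 0. The balls are disjoint, so each hidden input vanishes on its own ball and hence
identically. -/
theorem rowContrast_gatedMap_ballActivation_injective {k n m : ℕ} (hn : 2 ≤ n)
    {u : Fin m → Cube (k + n)} (hu : ∀ i j, i ≠ j → 4 ≤ hammingDist (u i) (u j))
    {o : Cube (k + n)} (ho : ∀ i, 4 ≤ hammingDist o (u i)) :
    Function.Injective (rowContrast k n ∘ₗ gatedMap (ballActivation u)) := by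
  refine (injective_iff_map_eq_zero _).2 fun θ hθ => ?_
  have hrow (x : Cube k) (y y' : Cube n) :
      gatedMap (ballActivation u) θ x y = gatedMap (ballActivation u) θ x y' := by
    have h (y) := congrFun (congrFun hθ x) y
    simp only [LinearMap.comp_apply, rowContrast_apply, Pi.zero_apply, sub_eq_zero] at h
    rw [h y, h y']
  have hout {x : Cube k} {y : Cube n} (h : ∀ i, 1 < hammingDist (Fin.append x y) (u i)) :
      gatedMap (ballActivation u) θ x y = outputInput y θ := by
    simp [gatedMap_apply, ballActivation, fun i => (h i).not_ge]
  have hb : θ.2.2.1 = 0 := by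
    obtain ⟨x, y, rfl⟩ : ∃ (x : Cube k) (y : Cube n), o = Fin.append x y :=
      ⟨_, _, (Fin.append_castAdd_natAdd (f := o)).symm⟩
    have hfar (v : Cube (k + n)) (hv : hammingDist v (Fin.append x y) ≤ 1) (i : Fin m) :
        1 < hammingDist v (u i) := by
      have h1 := ho i
      have h2 := hammingDist_triangle_left (Fin.append x y) (u i) v
      omega
    funext j
    have hy := hammingDist_update_le_one (Fin.append x y) (Fin.natAdd k j) (!y j)
    rw [← append_update_right] at hy
    have hj := hrow x (Function.update y j (!y j)) y
    rw [hout (hfar _ hy), hout (hfar _ (by rw [hammingDist_self]; exact zero_le_one)),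
      outputInput_apply θ x, outputInput_apply θ x, append_update_right] at hj
    have hq := cubeAffine_update_not 0 (Fin.append 0 θ.2.2.1) (Fin.append x y) (Fin.natAdd k j)
    simp only [Fin.append_right] at hq
    rw [hj, left_eq_add] at hq
    have := one_sub_two_mul_bit_mul_self (y j)
    rcases mul_eq_zero.1 hq with h | h
    · exact h
    · simp [h] at this
  have hob (y : Cube n) : outputInput y θ = 0 := by simp [outputInput, hb]
  have hz (x : Cube k) (y : Cube n) : gatedMap (ballActivation u) θ x y = 0 := by
    obtain ⟨y', hy'⟩ := exists_hammingDist_append_gt_one hn hu x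
    rw [hrow x y y', hout hy', hob]
  have haff (i : Fin m) : θ.2.2.2 i = 0 ∧ Fin.append (θ.1 i) (θ.2.1 i) = 0 := by
    refine eq_zero_of_cubeAffine_eq_zero_on_ball (u := u i) fun v hv => ?_
    obtain ⟨x, y, rfl⟩ : ∃ (x : Cube k) (y : Cube n), v = Fin.append x y :=
      ⟨_, _, (Fin.append_castAdd_natAdd (f := v)).symm⟩
    have h := hz x y
    rw [gatedMap_apply, hob, zero_add, Finset.sum_eq_single i] at h
    · rw [← hiddenInput_apply]
      simpa [ballActivation, hv] using h
    · intro i' _ hne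
      have h1 := hu i' i hne
      have h2 := hammingDist_triangle_left (u i') (u i) (Fin.append x y)
      rw [ballActivation, if_neg (by omega), zero_mul]
    · simp
  have hV : θ.1 = 0 := by
    ext i j
    simpa using congrFun (haff i).2 (Fin.castAdd n j)
  have hW : θ.2.1 = 0 := by
    ext i j
    simpa using congrFun (haff i).2 (Fin.natAdd k j)
  exact Prod.ext hV (Prod.ext hW (Prod.ext hb (funext fun i => (haff i).1)))

/-! ### Dimension counts and upper bounds -/

theorem finrank_crbmParam (k n m : ℕ) : finrank ℝ (CRBMParam k n m) = (k + n + 1) * m + n := by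
  simp [finrank_pi_fintype]
  ring

/-- A matrix in the kernel has constant rows, hence is determined by its column at `y = 0`; the
kernel has dimension at most `2 ^ k`. -/
theorem finrank_range_rowContrast (k n : ℕ) :
    2 ^ k * (2 ^ n - 1) ≤ finrank ℝ (LinearMap.range (rowContrast k n)) := by
  have h1 := (rowContrast k n).finrank_range_add_finrank_ker
  let e : LinearMap.ker (rowContrast k n) →ₗ[ℝ] (Cube k → ℝ) :=
    (LinearMap.pi fun x => (LinearMap.proj fun _ : Fin n => false) ∘ₗ LinearMap.proj x) ∘ₗ
      (LinearMap.ker (rowContrast k n)).subtype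
  have he : Function.Injective e := by
    refine (injective_iff_map_eq_zero _).2 fun f hf => ?_
    ext x y
    have h1 : (f : Cube k → Cube n → ℝ) x (fun _ => false) = 0 := congrFun hf x
    have h2 := congrFun (congrFun (LinearMap.mem_ker.1 f.2) x) y
    rw [rowContrast_apply, h1, sub_zero] at h2
    exact h2
  have h2 := LinearMap.finrank_le_finrank_of_injective he
  simp [finrank_pi_fintype] at h1 h2
  rw [Nat.mul_sub, mul_one]
  omega

theorem dimH_CRBM_le_card_param (k n m : ℕ) :
    dimH (CRBM k n m) ≤ ((k + n + 1) * m + n : ℕ) := by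
  rw [← finrank_crbmParam]
  exact ((contDiff_crbmMap k n m).of_le (by exact_mod_cast le_top)).dimH_range_le

theorem sum_crbmMap {k n m : ℕ} (θ : CRBMParam k n m) (x : Cube k) :
    ∑ y, crbmMap k n m θ x y = 1 := by
  simp only [crbmMap]
  rw [← Finset.sum_div]
  exact div_self (crbmZ_pos θ x).ne'

/-- The sums of the rows of a matrix. -/
def rowSum (k n : ℕ) : (Cube k → Cube n → ℝ) →ₗ[ℝ] (Cube k → ℝ) :=
  LinearMap.pi fun x => ∑ y, LinearMap.proj y ∘ₗ LinearMap.proj x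

theorem rowSum_apply {k n : ℕ} (f : Cube k → Cube n → ℝ) (x : Cube k) :
    rowSum k n f x = ∑ y, f x y := by
  simp [rowSum]

theorem finrank_ker_rowSum (k n : ℕ) :
    finrank ℝ (LinearMap.ker (rowSum k n)) = 2 ^ k * (2 ^ n - 1) := by
  have hs : LinearMap.range (rowSum k n) = ⊤ := by
    refine LinearMap.range_eq_top.2 fun g => ⟨fun x y => if y = fun _ => false then g x else 0, ?_⟩
    ext x
    simp [rowSum_apply]
  have h := (rowSum k n).finrank_range_add_finrank_ker
  rw [hs, finrank_top] at h
  simp [finrank_pi_fintype] at h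
  rw [Nat.mul_sub, mul_one]
  omega

theorem dimH_CRBM_le_polytope (k n m : ℕ) :
    dimH (CRBM k n m) ≤ (2 ^ k * (2 ^ n - 1) : ℕ) := by
  let f : LinearMap.ker (rowSum k n) → Cube k → Cube n → ℝ := fun g => crbmMap k n m 0 + g
  have hf : ContDiff ℝ 1 f :=
    contDiff_const.add (LinearMap.ker (rowSum k n)).subtypeL.contDiff
  refine (dimH_mono ?_).trans (hf.dimH_range_le.trans_eq (by rw [finrank_ker_rowSum]))
  rintro _ ⟨θ, rfl⟩
  refine ⟨⟨crbmMap k n m θ - crbmMap k n m 0, ?_⟩, by simp [f]⟩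
  ext x
  simp [rowSum_apply, sum_crbmMap]

/-- Every rank is at most the Hausdorff dimension, hence at most `d`; a single parameter reaching
`d` forces equality throughout. -/
theorem CRBMHasDim.of_dimH_le_of_le_rank {k n m d : ℕ} (h : dimH (CRBM k n m) ≤ d)
    (θ : CRBMParam k n m) (hθ : d ≤ crbmJacobianRank k n m θ) : CRBMHasDim k n m d := by
  have hr (η : CRBMParam k n m) : (crbmJacobianRank k n m η : ENNReal) ≤ dimH (CRBM k n m) :=
    finrank_range_fderiv_le_dimH_range
      ((contDiff_crbmMap k n m).of_le (by exact_mod_cast le_top)) η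
  have hle (η : CRBMParam k n m) : crbmJacobianRank k n m η ≤ d := by
    exact_mod_cast (hr η).trans h
  refine ⟨h.antisymm (le_trans (by exact_mod_cast hθ) (hr θ)), ⟨θ, (hle θ).antisymm hθ⟩, ?_⟩
  rintro _ ⟨η, rfl⟩
  exact hle η

/-! ### Codes, coverings and conclusion -/

theorem exists_code_of_le_codeA {N d M : ℕ} (h : M ≤ codeA N d) :
    ∃ u : Fin M → Cube N, ∀ i j, i ≠ j → d ≤ hammingDist (u i) (u j) := by
  obtain ⟨C, hC, hcard⟩ : codeA N d ∈ {N' | ∃ C : Finset (Cube N),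
      (∀ u ∈ C, ∀ v ∈ C, u ≠ v → d ≤ hammingDist u v) ∧ C.card = N'} := by
    refine Nat.sSup_mem ⟨0, ∅, by simp⟩ ⟨Fintype.card (Cube N), ?_⟩
    rintro _ ⟨C, -, rfl⟩
    exact C.card_le_univ
  let e : Fin M ↪ C := (Fin.castLEEmb (h.trans hcard.ge)).trans
    C.equivFin.symm.toEmbedding
  exact ⟨fun i => e i, fun i j hij => hC _ (e i).2 _ (e j).2
    fun h => hij (e.injective (Subtype.ext h))⟩

theorem exists_cover_of_coverK_le {N d M : ℕ} (h : coverK N d ≤ M) :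
    ∃ u : Fin M → Cube N, ∀ v, ∃ i, hammingDist v (u i) ≤ d := by
  obtain ⟨C, hC, hcard⟩ : coverK N d ∈ {N' | ∃ C : Finset (Cube N),
      (∀ v : Cube N, ∃ u ∈ C, hammingDist v u ≤ d) ∧ C.card = N'} :=
    Nat.sInf_mem ⟨_, Finset.univ, fun v => ⟨v, by simp⟩, rfl⟩
  obtain ⟨o, ho, -⟩ := hC fun _ => false
  let e := C.equivFin
  -- Surplus indices repeat a center, which keeps the covering property.
  refine ⟨fun i => if hi : (i : ℕ) < C.card then e.symm ⟨i, hi⟩ else o, fun v => ?_⟩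
  obtain ⟨w, hw, hvw⟩ := hC v
  refine ⟨Fin.castLE (hcard.le.trans h) (e ⟨w, hw⟩), ?_⟩
  simpa using hvw

theorem theorem1 (k n m : ℕ) :
    (2 ≤ n → m + 1 ≤ codeA (k + n) 4 → CRBMHasDim k n m ((k + n + 1) * m + n)) ∧
    (coverK (k + n) 1 ≤ m → CRBMHasDim k n m (2 ^ k * (2 ^ n - 1))) := by
  constructor
  · intro hn hm
    obtain ⟨u, hu⟩ := exists_code_of_le_codeA hm
    -- Of the `m + 1` codewords, `u 0` is left without a hidden unit, to detect the output biases.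
    obtain ⟨θ, hθ⟩ := exists_finrank_range_ballActivation_le fun i : Fin m => u i.succ
    refine .of_dimH_le_of_le_rank (dimH_CRBM_le_card_param k n m) θ (le_trans ?_ hθ)
    rw [LinearMap.finrank_range_of_inj, finrank_crbmParam]
    exact rowContrast_gatedMap_ballActivation_injective hn
      (fun i j hij => hu _ _ fun h => hij (Fin.succ_injective _ h))
      (o := u 0) fun i => hu _ _ (Fin.succ_ne_zero i).symm
  · intro hm
    obtain ⟨u, hu⟩ := exists_cover_of_coverK_le hm
    obtain ⟨θ, hθ⟩ := exists_finrank_range_ballActivation_le u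
    refine .of_dimH_le_of_le_rank (dimH_CRBM_le_polytope k n m) θ (le_trans ?_ hθ)
    rw [LinearMap.range_comp, LinearMap.range_eq_top.2 (gatedMap_ballActivation_surjective hu),
      Submodule.map_top]
    exact finrank_range_rowContrast k n
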